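/- A class of groups $\mathcal{C}$ (closed under isomorphism) is called a root class if it contains at least one non-trivial group and is closed under taking subgroups, extensions, and Cartesian products of the form $\prod_{y\in Y}X_y$, where $X,Y\in\mathcal{C}$ and $X_y$ is an isomorphic copy of $X$ for each $y\in Y$. For a class $\mathcal{C}$ consisting only of periodic groups, let $\mathfrak{P}(\mathcal{C})$ be the set of all primes each of which divides the order of an element of some $\mathcal{C}$-group, and let $\mathfrak{P}(\mathcal{C})'$ be the set of all primes not in $\mathfrak{P}(\mathcal{C})$. An abelian group $A$ is called $\mathcal{C}$-bounded if, for every quotient group $B$ of $A$ and every $p\in\mathfrak{P}(\mathcal{C})$, the subgroup of all elements of $p$-power order of $B$ has finite exponent and cardinality not exceeding the cardinality of some $\mathcal{C}$-group. A nilpotent group is called $\mathcal{C}$-bounded if it has at least one finite central series all of whose factors are $\mathcal{C}$-bounded abelian groups. A group $X$ is residually a $\mathcal{C}$-group if, for every $x\in X\setminus\{1\}$, there is a homomorphism $\sigma$ of $X$ onto a group from $\mathcal{C}$ such that $x\sigma\neq 1$. A group $X$ has no $\mathfrak{P}(\mathcal{C})'$-torsion if, for all $x\in X$ and $q\in\mathfrak{P}(\mathcal{C})'$,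 the equality $x^q=1$ implies $x=1$. **Proposition.** Let $\mathcal{C}$ be a root class of groups consisting only of periodic groups, and let $X$ be a $\mathcal{C}$-bounded nilpotent group. Then $X$ is residually a $\mathcal{C}$-group if and only if it has no $\mathfrak{P}(\mathcal{C})'$-torsion. -/

import Mathlib

universe u

/-- A class of groups (in a fixed universe), as a predicate. Isomorphism-invariance is required
separately, in `IsRootClass`. -/
abbrev GroupClass : Type (u + 1) := ∀ (G : Type u) [Group G], Prop

namespace GroupClass

/-- A root class of groups: an isomorphism-closed class that contains a non-trivial group and is
closed under subgroups, extensions, and Cartesian powers `∏_{y ∈ Y} X` with `X, Y` in the class. -/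
structure IsRootClass (C : GroupClass.{u}) : Prop where
  iso : ∀ (G H : Type u) [Group G] [Group H], (G ≃* H) → C G → C H
  exists_nontrivial : ∃ (G : Type u) (_ : Group G), Nontrivial G ∧ C G
  subgroup : ∀ (G : Type u) [Group G] (H : Subgroup G), C G → C H
  extension : ∀ (G : Type u) [Group G] (N : Subgroup G) [N.Normal], C N → C (G ⧸ N) → C G
  pi : ∀ (X Y : Type u) [Group X] [Group Y], C X → C Y → C (Y → X)

/-- The class consists only of periodic groups: every element has finite order. -/
def IsPeriodic (C : GroupClass.{u}) : Prop :=
  ∀ (G : Type u) [Group G], C G → ∀ g : G, IsOfFinOrder g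

/-- The set `𝔓(C)` of the primes that divide the order of an element of some `C`-group. -/
def primes (C : GroupClass.{u}) : Set ℕ :=
  {p | p.Prime ∧ ∃ (G : Type u) (_ : Group G), C G ∧ ∃ g : G, IsOfFinOrder g ∧ p ∣ orderOf g}

/-- `Y` is `C`-separable in `X`: each `x ∉ Y` is separated from `Y` by a homomorphism of `X` onto
a `C`-group. -/
def IsSeparable (C : GroupClass.{u}) {X : Type u} [Group X] (Y : Subgroup X) : Prop :=
  ∀ x : X, x ∉ Y → ∃ (K : Type u) (_ : Group K) (σ : X →* K),
    C K ∧ Function.Surjective σ ∧ σ x ∉ Y.map σ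

/-- `X` is residually a `C`-group: its trivial subgroup is `C`-separable. -/
def IsResidually (C : GroupClass.{u}) (X : Type u) [Group X] : Prop :=
  C.IsSeparable (⊥ : Subgroup X)

/-- The elements of `p`-power order of a group (for an abelian group, its `p`-primary
component). -/
def pPowerTorsion (p : ℕ) (B : Type u) [Group B] : Set B :=
  {b | ∃ k : ℕ, b ^ p ^ k = 1}

/-- `A` is a `C`-bounded abelian group: it is abelian and, for each quotient group of `A` and each
`p ∈ 𝔓(C)`, the `p`-primary component of the quotient has finite exponent and its cardinality does
not exceed that of some `C`-group. -/
def IsBoundedAbelian (C : GroupClass.{u}) (A : Type u) [Group A] : Prop :=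
  (∀ a b : A, a * b = b * a) ∧
    ∀ (N : Subgroup A) [N.Normal], ∀ p ∈ C.primes,
      (∃ m : ℕ, 0 < m ∧ ∀ b ∈ pPowerTorsion p (A ⧸ N), b ^ m = 1) ∧
      ∃ (K : Type u) (_ : Group K), C K ∧
        Cardinal.mk (pPowerTorsion p (A ⧸ N)) ≤ Cardinal.mk K

/-- `X` is a `C`-bounded nilpotent group: it is nilpotent and has a finite central series
`1 = H 0 ≤ H 1 ≤ ⋯ ≤ H n = X` all of whose factors `H (i + 1) / H i` are `C`-bounded abelian
groups. -/
def IsBoundedNilpotent (C : GroupClass.{u}) (X : Type u) [Group X] : Prop :=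
  Group.IsNilpotent X ∧
    ∃ (n : ℕ) (H : ℕ → Subgroup X) (_ : ∀ i, (H i).Normal),
      H 0 = ⊥ ∧ H n = ⊤ ∧
      ∀ i < n, H i ≤ H (i + 1) ∧
        (∀ x ∈ H (i + 1), ∀ g : X, x * g * x⁻¹ * g⁻¹ ∈ H i) ∧
        C.IsBoundedAbelian (H (i + 1) ⧸ (H i).subgroupOf (H (i + 1)))

end GroupClass

/-- For a set `P` of primes, the set `P'` of the primes that are not in `P`. -/
def primeCompl (P : Set ℕ) : Set ℕ := {q | q.Prime ∧ q ∉ P}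

/-- `Y` is `Q`-isolated in `X`, for a set `Q` of primes. -/
def IsIsolated (Q : Set ℕ) {X : Type u} [Group X] (Y : Subgroup X) : Prop :=
  ∀ x : X, ∀ q ∈ Q, x ^ q ∈ Y → x ∈ Y

/-- `X` has no `Q`-torsion: its trivial subgroup is `Q`-isolated. -/
def HasNoTorsion (Q : Set ℕ) (X : Type u) [Group X] : Prop :=
  IsIsolated Q (⊥ : Subgroup X)

/-! A homomorphism onto a periodic group that keeps an element of prime order `q` alive shows that
`q` divides an order in the class; this gives one direction. Conversely, for `x ≠ 1` the normal
closure of `x` contains a central `y ≠ 1`, and absence of torsion gives a prime `p` of the class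
dividing the order of `y`. Let `N` be maximal among the normal subgroups that contain `y ^ p` but
not `y`. In `X ⧸ N` the image of `y` has order `p` and lies in every non-trivial normal subgroup.
Hence the centre is a `p`-group, boundedness gives it finite exponent, and nilpotency makes `X ⧸ N`
a `p`-group (`IsBoundedNilpotent.isPGroup`). A bounded nilpotent `p`-group belongs to the class
(`IsRootClass.of_isBoundedNilpotent`), and `x ∉ N` since `y ∉ N`. -/

namespace GroupClass

variable {C : GroupClass.{u}}

/-! ### Abelian `p`-groups in a root class -/

theorem IsRootClass.of_injective (hC : C.IsRootClass) {G H : Type u} [Group G] [Group H]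
    (f : G →* H) (hf : Function.Injective f) (hH : C H) : C G :=
  hC.iso _ _ (MonoidHom.ofInjective hf).symm (hC.subgroup H f.range hH)

theorem IsRootClass.of_subsingleton (hC : C.IsRootClass) (G : Type u) [Group G]
    [Subsingleton G] : C G := by
  obtain ⟨H, _, -, hH⟩ := hC.exists_nontrivial
  exact hC.of_injective (1 : G →* H) (Function.injective_of_subsingleton _) hH

theorem IsRootClass.of_ker_of_range (hC : C.IsRootClass) {G H : Type u} [Group G] [Group H]
    (f : G →* H) (hker : C f.ker) (hrange : C f.range) : C G :=
  hC.extension G f.ker hker (hC.iso _ _ (QuotientGroup.quotientKerEquivRange f).symm hrange)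

/-- A root class contains the cyclic groups whose orders are primes of the class. -/
theorem IsRootClass.zmod (hC : C.IsRootClass) {p : ℕ} (hp : p ∈ C.primes) :
    C (ULift.{u} (Multiplicative (ZMod p))) := by
  obtain ⟨hpp, G, _, hG, g, hg, hpg⟩ := hp
  have := Fact.mk hpp
  have hord : orderOf (g ^ (orderOf g / p)) = p :=
    orderOf_pow_orderOf_div hg.orderOf_pos.ne' hpg
  have hcard : Nat.card (ULift.{u} (Multiplicative (ZMod p))) =
      Nat.card (Subgroup.zpowers (g ^ (orderOf g / p))) := by
    rw [Nat.card_zpowers, hord]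
    simp
  have : IsCyclic (ULift.{u} (Multiplicative (ZMod p))) :=
    isCyclic_of_prime_card (p := p) (by simp)
  exact hC.iso _ _ (mulEquivOfCyclicCardEq hcard).symm (hC.subgroup G _ hG)

theorem IsRootClass.primes_nonempty (hC : C.IsRootClass) (hper : C.IsPeriodic) :
    C.primes.Nonempty := by
  obtain ⟨G, _, _, hG⟩ := hC.exists_nontrivial
  obtain ⟨g, hg⟩ := exists_ne (1 : G)
  obtain ⟨p, hp, hpg⟩ := Nat.exists_prime_and_dvd (mt orderOf_eq_one_iff.1 hg)
  exact ⟨p, hp, G, _, hG, g, hper G hG g, hpg⟩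

/-- An elementary abelian group no larger than a member of a root class lies in the class. -/
theorem IsRootClass.of_pow_prime_eq_one (hC : C.IsRootClass) {p : ℕ} (hp : p ∈ C.primes)
    {A K : Type u} [CommGroup A] [Group K] (hK : C K) (hA : ∀ a : A, a ^ p = 1)
    (hcard : Cardinal.mk A ≤ Cardinal.mk K) : C A := by
  have := Fact.mk hp.1
  let _ : Module (ZMod p) (Additive A) := AddCommGroup.zmodModule (n := p) (fun a => hA a.toMul)
  obtain ⟨e⟩ := hcard
  have hdual : ∀ a : Additive A, ∃ f : Additive A →ₗ[ZMod p] ZMod p, a ≠ 0 → f a ≠ 0 := by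
    intro a
    by_cases ha : a = 0
    · exact ⟨0, fun h => (h ha).elim⟩
    · obtain ⟨f, hf⟩ := not_forall.1 (mt (Module.forall_dual_apply_eq_zero_iff (ZMod p) a).1 ha)
      exact ⟨f, fun _ => hf⟩
  choose f hf using hdual
  -- The coordinates are indexed by `K`, so that closure under `pi` applies; a `k` outside the range
  -- of `e` gives a harmless extra functional.
  let φ : A →* (K → ULift.{u} (Multiplicative (ZMod p))) :=
    { toFun := fun a k =>
        ULift.up (Multiplicative.ofAdd (f (Additive.ofMul (Function.invFun e k)) (Additive.ofMul a)))
      map_one' := by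
        funext k
        simp only [ofMul_one, map_zero, ofAdd_zero]
        rfl
      map_mul' := fun a b => by
        funext k
        simp only [ofMul_mul, map_add, ofAdd_add]
        rfl }
  refine hC.of_injective φ ((injective_iff_map_eq_one φ).2 fun a ha => ?_) (hC.pi _ _ (hC.zmod hp) hK)
  by_contra hne
  refine hf (Additive.ofMul a) hne ?_
  have h := congrFun ha (e a)
  simp only [φ, MonoidHom.coe_mk, OneHom.coe_mk, Function.leftInverse_invFun e.injective a] at h
  exact congrArg (fun t => Multiplicative.toAdd (ULift.down t)) h

/-- An abelian `p`-group of finite exponent no larger than a member of a root class lies in the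
class. -/
theorem IsRootClass.of_pow_prime_pow_eq_one (hC : C.IsRootClass) {p : ℕ} (hp : p ∈ C.primes)
    {K : Type u} [Group K] (hK : C K) (k : ℕ) (A : Type u) [CommGroup A]
    (hA : ∀ a : A, a ^ p ^ k = 1) (hcard : Cardinal.mk A ≤ Cardinal.mk K) : C A := by
  induction k generalizing A with
  | zero =>
    have : Subsingleton A := ⟨fun a b => by
      rw [← pow_one a, ← pow_one b, ← pow_zero p, hA, hA]⟩
    exact hC.of_subsingleton A
  | succ k ih =>
    refine hC.of_ker_of_range (powMonoidHom p : A →* A) ?_ ?_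
    · refine hC.of_pow_prime_eq_one hp hK (fun a => Subtype.ext a.2) ?_
      exact (Cardinal.mk_subtype_le _).trans hcard
    · refine ih _ ?_ ((Cardinal.mk_subtype_le _).trans hcard)
      rintro ⟨_, b, rfl⟩
      refine Subtype.ext ?_
      change (b ^ p) ^ p ^ k = 1
      rw [← pow_mul, ← pow_succ', hA]

/-! ### Bounded abelian and bounded nilpotent groups -/

theorem IsBoundedAbelian.exists_exponent {A : Type u} [Group A] (hA : C.IsBoundedAbelian A)
    {p : ℕ} (hp : p ∈ C.primes) : ∃ m : ℕ, 0 < m ∧ ∀ a ∈ pPowerTorsion p A, a ^ m = 1 := by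
  obtain ⟨⟨m, hm, h⟩, -⟩ := hA.2 ⊥ p hp
  refine ⟨m, hm, fun a ⟨k, hk⟩ => ?_⟩
  have := h (a : A ⧸ (⊥ : Subgroup A)) ⟨k, by rw [← QuotientGroup.mk_pow, hk]; rfl⟩
  rwa [← QuotientGroup.mk_pow, QuotientGroup.eq_one_iff, Subgroup.mem_bot] at this

theorem IsBoundedAbelian.of_surjective {A B : Type u} [Group A] [Group B]
    (hA : C.IsBoundedAbelian A) (f : A →* B) (hf : Function.Surjective f) :
    C.IsBoundedAbelian B := by
  refine ⟨fun a b => ?_, fun N _ p hp => ?_⟩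
  · obtain ⟨a, rfl⟩ := hf a
    obtain ⟨b, rfl⟩ := hf b
    rw [← map_mul, hA.1, map_mul]
  · let e := QuotientGroup.quotientKerEquivOfSurjective ((QuotientGroup.mk' N).comp f)
      ((QuotientGroup.mk'_surjective N).comp hf)
    have he : ∀ b ∈ pPowerTorsion p (B ⧸ N), e.symm b ∈ pPowerTorsion p _ :=
      fun b ⟨k, hk⟩ => ⟨k, by rw [← map_pow, hk, map_one]⟩
    obtain ⟨⟨m, hm, h⟩, K, _, hK, hcard⟩ := hA.2 ((QuotientGroup.mk' N).comp f).ker p hp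
    refine ⟨⟨m, hm, fun b hb => ?_⟩, K, _, hK, le_trans ?_ hcard⟩
    · rw [← e.symm.map_eq_one_iff, map_pow, h _ (he b hb)]
    · exact Cardinal.mk_le_of_injective (f := fun b => ⟨e.symm b.1, he b.1 b.2⟩)
        fun a b hab => Subtype.ext (e.symm.injective (congrArg Subtype.val hab))

theorem IsRootClass.of_isBoundedAbelian (hC : C.IsRootClass) {p : ℕ} (hp : p ∈ C.primes)
    {A : Type u} [Group A] (hA : C.IsBoundedAbelian A) (hpA : IsPGroup p A) : C A := by
  have := Fact.mk hp.1
  let _ : CommGroup A := { ‹Group A› with mul_comm := hA.1 }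
  obtain ⟨m, hm, hexp⟩ := hA.exists_exponent hp
  obtain ⟨-, K, _, hK, hcard⟩ := hA.2 ⊥ p hp
  refine hC.of_pow_prime_pow_eq_one hp hK m A (fun a => ?_) (le_trans ?_ hcard)
  · obtain ⟨k, hk⟩ := IsPGroup.iff_orderOf.1 hpA a
    have hdvd := orderOf_dvd_of_pow_eq_one (hexp a (hpA a))
    rw [hk] at hdvd
    rw [← orderOf_dvd_iff_pow_eq_one, hk]
    -- From `p ^ k ∣ m` follows `k < p ^ k ≤ m`, so `p ^ m` is a uniform exponent.
    exact pow_dvd_pow _ ((Nat.lt_pow_self hp.1.one_lt).le.trans (Nat.le_of_dvd hm hdvd))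
  · refine Cardinal.mk_le_of_injective
      (f := fun a : A => ⟨QuotientGroup.mk' (⊥ : Subgroup A) a, ?_⟩) fun a b hab => ?_
    · obtain ⟨k, hk⟩ := hpA a
      exact ⟨k, by rw [← map_pow, hk, map_one]⟩
    · exact QuotientGroup.quotientBot.symm.injective (congrArg Subtype.val hab)

theorem IsBoundedNilpotent.of_surjective {X G : Type u} [Group X] [Group G]
    (hX : C.IsBoundedNilpotent X) (f : X →* G) (hf : Function.Surjective f) :
    C.IsBoundedNilpotent G := by
  obtain ⟨hnil, n, H, hH, h0, hn, hs⟩ := hX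
  refine ⟨Group.nilpotent_of_surjective f hf, n, fun i => (H i).map f, fun i => (hH i).map f hf, ?_, ?_,
    fun i hi => ⟨Subgroup.map_mono (hs i hi).1, ?_, ?_⟩⟩
  · simp [h0]
  · simp [hn, Subgroup.map_top_of_surjective f hf]
  · rintro _ ⟨x, hx, rfl⟩ g
    obtain ⟨g, rfl⟩ := hf g
    exact ⟨_, (hs i hi).2.1 x hx g, by simp⟩
  · have := (hH i).map f hf
    refine (hs i hi).2.2.of_surjective (B := _ ⧸ ((H i).map f).subgroupOf ((H (i + 1)).map f))
      (QuotientGroup.map _ _ (f.subgroupMap (H (i + 1))) ?_) ?_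
    · intro x hx
      exact ⟨x.1, hx, rfl⟩
    · exact QuotientGroup.map_surjective_of_surjective _ _ _
        ((QuotientGroup.mk'_surjective _).comp (f.subgroupMap_surjective _)) _

theorem IsBoundedNilpotent.exists_exponent {G : Type u} [Group G] (hG : C.IsBoundedNilpotent G)
    {p : ℕ} (hp : p ∈ C.primes) : ∃ m : ℕ, 0 < m ∧ ∀ g ∈ pPowerTorsion p G, g ^ m = 1 := by
  obtain ⟨-, n, H, hH, h0, hn, hs⟩ := hG
  have key : ∀ i ≤ n, ∃ m : ℕ, 0 < m ∧ ∀ g ∈ H i, g ∈ pPowerTorsion p G → g ^ m = 1 := by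
    intro i
    induction i with
    | zero => exact fun _ => ⟨1, one_pos, fun g hg _ => by simpa [h0] using hg⟩
    | succ i ih =>
      intro hi
      obtain ⟨m, hm, h⟩ := ih (Nat.le_of_succ_le hi)
      obtain ⟨l, hl, h'⟩ := (hs i hi).2.2.exists_exponent hp
      refine ⟨l * m, Nat.mul_pos hl hm, fun g hg ⟨k, hk⟩ => ?_⟩
      rw [pow_mul]
      refine h _ ?_ ⟨k, by rw [pow_right_comm, hk, one_pow]⟩
      have := h' (QuotientGroup.mk' _ (⟨g, hg⟩ : H (i + 1)))
        ⟨k, by rw [← map_pow, show (⟨g, hg⟩ : H (i + 1)) ^ p ^ k = 1 from Subtype.ext hk, map_one]⟩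
      rw [← map_pow, QuotientGroup.mk'_apply, QuotientGroup.eq_one_iff] at this
      exact this
  obtain ⟨m, hm, h⟩ := key n le_rfl
  exact ⟨m, hm, fun g hg => h g (hn ▸ Subgroup.mem_top g) hg⟩

/-- Closure under extensions lifts membership up the central series, whose factors are bounded
abelian `p`-groups. -/
theorem IsRootClass.of_isBoundedNilpotent (hC : C.IsRootClass) {p : ℕ} (hp : p ∈ C.primes)
    {G : Type u} [Group G] (hG : C.IsBoundedNilpotent G) (hpG : IsPGroup p G) : C G := by
  obtain ⟨-, n, H, hH, h0, hn, hs⟩ := hG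
  have key : ∀ i ≤ n, C (H i) := by
    intro i
    induction i with
    | zero =>
      intro _
      rw [h0]
      exact hC.of_subsingleton _
    | succ i ih =>
      intro hi
      obtain ⟨hle, -, hb⟩ := hs i hi
      exact hC.extension _ ((H i).subgroupOf (H (i + 1)))
        (hC.iso _ _ (Subgroup.subgroupOfEquivOfLe hle).symm (ih (Nat.le_of_succ_le hi)))
        (hC.of_isBoundedAbelian hp hb ((hpG.to_subgroup _).to_quotient _))
  have htop := key n le_rfl
  rw [hn] at htop
  exact hC.iso _ _ Subgroup.topEquiv htop

end GroupClass

/-! ### Centres and normal subgroups of nilpotent groups -/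

open scoped commutatorElement in
/-- If the centre has exponent dividing `m`, then so have all upper central factors. -/
theorem pow_mem_upperCentralSeries {G : Type*} [Group G] {m : ℕ}
    (hm : ∀ z ∈ Subgroup.center G, z ^ m = 1) (i : ℕ) :
    ∀ x ∈ Subgroup.upperCentralSeries G (i + 1), x ^ m ∈ Subgroup.upperCentralSeries G i := by
  induction i with
  | zero =>
    intro x hx
    rw [zero_add, Subgroup.upperCentralSeries_one] at hx
    simpa using hm x hx
  | succ i ih =>
    intro x hx g
    let π := QuotientGroup.mk' (Subgroup.upperCentralSeries G i)
    have hz : π ⁅x, g⁆ ∈ Subgroup.center _ := by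
      have h : ⁅x, g⁆ ∈ Subgroup.upperCentralSeriesStep (Subgroup.upperCentralSeries G i) := hx g
      rwa [Subgroup.upperCentralSeriesStep_eq_comap_center] at h
    have hzm : π ⁅x, g⁆ ^ m = 1 := by
      rw [← map_pow]
      exact (QuotientGroup.eq_one_iff _).2 (ih _ (hx g))
    -- Modulo the `i`-th term, `⁅x, g⁆` is central of exponent `m`, so raising this identity to the
    -- `m`-th power shows that `g` commutes with `x ^ m`.
    have hconj : π g * π x * (π g)⁻¹ = (π ⁅x, g⁆)⁻¹ * π x := by
      rw [map_commutatorElement, commutatorElement_def]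
      group
    have hpow : π g * π x ^ m * (π g)⁻¹ = π x ^ m := by
      rw [← conj_pow, hconj, Commute.mul_pow (Subgroup.mem_center_iff.1 (inv_mem hz) _).symm,
        inv_pow, hzm, inv_one, one_mul]
    refine (QuotientGroup.eq_one_iff (N := Subgroup.upperCentralSeries G i) _).1 ?_
    change π ⁅x ^ m, g⁆ = 1
    rw [map_commutatorElement, map_pow, commutatorElement_eq_one_iff_mul_comm]
    exact (mul_inv_eq_iff_eq_mul.1 hpow).symm

/-- A nilpotent group whose centre is a `p`-group of finite exponent is a `p`-group. -/
theorem isPGroup_of_center {G : Type*} [Group G] [Group.IsNilpotent G] {p a : ℕ}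
    (h : ∀ z ∈ Subgroup.center G, z ^ p ^ a = 1) : IsPGroup p G := by
  have key : ∀ i, ∀ x ∈ Subgroup.upperCentralSeries G i, ∃ k : ℕ, x ^ p ^ k = 1 := by
    intro i
    induction i with
    | zero => exact fun x hx => ⟨0, by simpa using hx⟩
    | succ i ih =>
      intro x hx
      obtain ⟨k, hk⟩ := ih _ (pow_mem_upperCentralSeries h i x hx)
      exact ⟨a + k, by rw [pow_add, pow_mul, hk]⟩
  obtain ⟨n, hn⟩ := Group.IsNilpotent.nilpotent G
  exact fun x => key n x (hn ▸ Subgroup.mem_top x)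

/-- A non-trivial normal subgroup of a nilpotent group meets the centre non-trivially. -/
theorem exists_mem_center_ne_one {G : Type*} [Group G] [Group.IsNilpotent G] (N : Subgroup G)
    [hN : N.Normal] {x : G} (hxN : x ∈ N) (hx : x ≠ 1) :
    ∃ z ∈ N, z ∈ Subgroup.center G ∧ z ≠ 1 := by
  by_contra! hcon
  have key : ∀ i, ∀ y ∈ Subgroup.upperCentralSeries G i, y ∈ N → y = 1 := by
    intro i
    induction i with
    | zero => exact fun y hy _ => by simpa using hy
    | succ i ih =>
      intro y hy hyN
      -- Commutators of `y` lie in `N` and one term lower, hence are trivial, so `y` is central.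
      refine hcon y hyN (Subgroup.mem_center_iff.2 fun g => ?_)
      have h := ih _ (hy g) (by
        rw [commutatorElement_def, mul_assoc, mul_assoc, ← mul_assoc g]
        exact N.mul_mem hyN (hN.conj_mem _ (N.inv_mem hyN) g))
      exact (commutatorElement_eq_one_iff_mul_comm.1 h).symm
  obtain ⟨n, hn⟩ := Group.IsNilpotent.nilpotent G
  exact hx (key n x (hn ▸ Subgroup.mem_top x) hxN)

theorem normal_zpowers_of_mem_center {G : Type*} [Group G] {z : G} (hz : z ∈ Subgroup.center G) :
    (Subgroup.zpowers z).Normal := by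
  refine ⟨fun a ha g => ?_⟩
  have : a ∈ Subgroup.center G := Subgroup.zpowers_le.2 hz ha
  rwa [Subgroup.mem_center_iff.1 this g, mul_inv_cancel_right]

/-- If `y = y ^ (p * k)`, then `p` divides `p * k - 1`. Infinite order is included, as `orderOf y =
0` then. -/
theorem notMem_zpowers_pow {G : Type*} [Group G] {y : G} {p : ℕ} (hp : p.Prime)
    (h : p ∣ orderOf y) : y ∉ Subgroup.zpowers (y ^ p) := by
  rintro ⟨k, hk⟩
  have h1 : y ^ ((p : ℤ) * k - 1) = 1 := by
    rw [zpow_sub, zpow_mul, zpow_natCast, zpow_one]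
    exact mul_inv_eq_one.2 hk
  have h2 := (Int.natCast_dvd_natCast.2 h).trans (orderOf_dvd_iff_zpow_eq_one.2 h1)
  have h3 : (p : ℤ) ∣ 1 := (dvd_sub_right (Dvd.intro k rfl)).1 h2
  exact hp.one_lt.ne' (Nat.dvd_one.1 (by exact_mod_cast h3))

/-- If every non-trivial normal subgroup contains a fixed element of order `p`, then the centre is
a `p`-group. -/
theorem exists_pow_eq_one_of_mem_center {G : Type*} [Group G] {p : ℕ} (hp : p.Prime) {y : G}
    (hy : y ≠ 1) (hyp : y ^ p = 1) (hmin : ∀ N : Subgroup G, N.Normal → N ≠ ⊥ → y ∈ N)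
    {z : G} (hz : z ∈ Subgroup.center G) : ∃ k : ℕ, z ^ p ^ k = 1 := by
  have hmem : ∀ w ∈ Subgroup.center G, w ≠ 1 → y ∈ Subgroup.zpowers w := fun w hw hw1 =>
    hmin _ (normal_zpowers_of_mem_center hw) (mt Subgroup.zpowers_eq_bot.1 hw1)
  by_cases hz1 : z = 1
  · exact ⟨0, by simp [hz1]⟩
  have hfin : IsOfFinOrder z := by
    obtain ⟨k, hk⟩ := hmem z hz hz1
    refine isOfFinOrder_iff_zpow_eq_one.2 ⟨k * p, ?_, ?_⟩
    · refine mul_ne_zero ?_ (by exact_mod_cast hp.ne_zero)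
      rintro rfl
      exact hy (by simpa using hk.symm)
    · rw [zpow_mul, zpow_natCast]
      exact (congrArg (· ^ p) hk).trans hyp
  obtain ⟨a, m, hm, hord⟩ :=
    Nat.exists_eq_pow_mul_and_not_dvd hfin.orderOf_pos.ne' p hp.ne_one
  -- If `z ^ p ^ a ≠ 1`, then `y` is a power of it, so `y ^ m = 1` with `m` prime to `p`.
  refine ⟨a, by_contra fun hw => hy ?_⟩
  obtain ⟨k, hk⟩ := hmem _ (pow_mem hz _) hw
  have hym : y ^ m = 1 := by
    rw [← hk]
    change ((z ^ p ^ a) ^ k) ^ m = 1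
    rw [← zpow_natCast, zpow_comm, zpow_natCast, ← pow_mul, ← hord, pow_orderOf_eq_one, one_zpow]
  have hcop : Nat.gcd p m = 1 := (hp.coprime_iff_not_dvd).2 hm
  have := Nat.dvd_gcd (orderOf_dvd_of_pow_eq_one hyp) (orderOf_dvd_of_pow_eq_one hym)
  rw [hcop, Nat.dvd_one] at this
  exact orderOf_eq_one_iff.1 this

/-- Among the normal subgroups above `M` that avoid `y` there is a maximal one. -/
theorem exists_maximal_normal_notMem {G : Type*} [Group G] (M : Subgroup G) (hM : M.Normal) {y : G}
    (hy : y ∉ M) : ∃ N : Subgroup G, N.Normal ∧ M ≤ N ∧ y ∉ N ∧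
      ∀ L : Subgroup G, L.Normal → N < L → y ∈ L := by
  obtain ⟨N, hMN, hN⟩ := zorn_le_nonempty₀ {N : Subgroup G | N.Normal ∧ y ∉ N} (by
    intro c hc hchain L hL
    have hmem : ∀ x, x ∈ sSup c ↔ ∃ N ∈ c, x ∈ N := fun x =>
      Subgroup.mem_sSup_of_directedOn ⟨L, hL⟩ hchain.directedOn
    refine ⟨sSup c, ⟨⟨fun x hx g => ?_⟩, fun h => ?_⟩, fun N hN => le_sSup hN⟩
    · obtain ⟨N, hN, hxN⟩ := (hmem x).1 hx
      exact (hmem _).2 ⟨N, hN, (hc hN).1.conj_mem x hxN g⟩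
    · obtain ⟨N, hN, hyN⟩ := (hmem y).1 h
      exact (hc hN).2 hyN) M ⟨hM, hy⟩
  exact ⟨N, hN.prop.1, hMN, hN.prop.2, fun L hL hlt =>
    by_contra fun hyL => hN.not_gt ⟨hL, hyL⟩ hlt⟩

/-! ### Residual properties and torsion -/

namespace GroupClass

variable {C : GroupClass.{u}}

theorem IsResidually.hasNoTorsion (hper : C.IsPeriodic) {X : Type u} [Group X]
    (hX : C.IsResidually X) : HasNoTorsion (primeCompl C.primes) X := by
  rintro x q ⟨hq, hqC⟩ hx
  by_contra hx1
  obtain ⟨K, _, σ, hK, -, hσ⟩ := hX x hx1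
  rw [Subgroup.map_bot, Subgroup.mem_bot] at hσ
  refine hqC ⟨hq, K, _, hK, σ x, hper K hK _, ?_⟩
  have := Fact.mk hq
  rw [orderOf_eq_prime (by rw [← map_pow, Subgroup.mem_bot.1 hx, map_one]) hσ]

theorem exists_prime_dvd_orderOf (hC : C.IsRootClass) (hper : C.IsPeriodic) {X : Type u}
    [Group X] (hX : HasNoTorsion (primeCompl C.primes) X) {y : X} (hy : y ≠ 1) :
    ∃ p ∈ C.primes, p ∣ orderOf y := by
  -- For `y` of infinite order any prime of the class will do.
  by_cases h0 : orderOf y = 0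
  · obtain ⟨p, hp⟩ := hC.primes_nonempty hper
    exact ⟨p, hp, h0 ▸ dvd_zero p⟩
  obtain ⟨p, hp, hdvd⟩ := Nat.exists_prime_and_dvd (mt orderOf_eq_one_iff.1 hy)
  refine ⟨p, by_contra fun hpC => ?_, hdvd⟩
  have hord := orderOf_pow_orderOf_div h0 hdvd
  have h1 : y ^ (orderOf y / p) = 1 := Subgroup.mem_bot.1 <| hX _ p ⟨hp, hpC⟩ <| by
    rw [Subgroup.mem_bot, ← pow_mul, Nat.div_mul_cancel hdvd, pow_orderOf_eq_one]
  rw [h1, orderOf_one] at hord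
  exact hp.ne_one hord.symm

/-- A bounded nilpotent group with an element of order `p` lying in every non-trivial normal
subgroup is a `p`-group. -/
theorem IsBoundedNilpotent.isPGroup {G : Type u} [Group G] (hG : C.IsBoundedNilpotent G) {p : ℕ}
    (hp : p ∈ C.primes) {y : G} (hy : y ≠ 1) (hyp : y ^ p = 1)
    (hmin : ∀ N : Subgroup G, N.Normal → N ≠ ⊥ → y ∈ N) : IsPGroup p G := by
  have := hG.1
  obtain ⟨m, hm, hexp⟩ := hG.exists_exponent hp
  refine isPGroup_of_center (a := m) fun z hz => ?_
  obtain ⟨k, hk⟩ := exists_pow_eq_one_of_mem_center hp.1 hy hyp hmin hz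
  obtain ⟨j, -, hj⟩ := (Nat.dvd_prime_pow hp.1).1 (orderOf_dvd_of_pow_eq_one hk)
  have hdvd := orderOf_dvd_of_pow_eq_one (hexp z ⟨k, hk⟩)
  rw [hj] at hdvd
  rw [← orderOf_dvd_iff_pow_eq_one, hj]
  exact pow_dvd_pow _ ((Nat.lt_pow_self hp.1.one_lt).le.trans (Nat.le_of_dvd hm hdvd))

theorem IsBoundedNilpotent.isResidually (hC : C.IsRootClass) (hper : C.IsPeriodic) {X : Type u}
    [Group X] (hX : C.IsBoundedNilpotent X) (htf : HasNoTorsion (primeCompl C.primes) X) :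
    C.IsResidually X := by
  intro x hx
  have := hX.1
  obtain ⟨y, hyx, hyc, hy1⟩ := exists_mem_center_ne_one (Subgroup.normalClosure {x})
    (Subgroup.subset_normalClosure rfl) hx
  obtain ⟨p, hp, hpy⟩ := exists_prime_dvd_orderOf hC hper htf hy1
  obtain ⟨N, hN, hle, hyN, hmax⟩ := exists_maximal_normal_notMem _
    (normal_zpowers_of_mem_center (pow_mem hyc p)) (notMem_zpowers_pow hp.1 hpy)
  have hG := hX.of_surjective (QuotientGroup.mk' N) (QuotientGroup.mk'_surjective N)
  refine ⟨X ⧸ N, inferInstance, QuotientGroup.mk' N, hC.of_isBoundedNilpotent hp hG ?_,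
    QuotientGroup.mk'_surjective N, fun h => hyN ?_⟩
  · refine hG.isPGroup hp (y := (y : X ⧸ N)) (mt (QuotientGroup.eq_one_iff y).1 hyN)
      ((QuotientGroup.eq_one_iff (y ^ p)).2 (hle (Subgroup.mem_zpowers _))) fun L hL hL1 => ?_
    -- A non-trivial normal subgroup of `X ⧸ N` pulls back to one strictly above `N`, which contains
    -- `y` by maximality.
    refine hmax (L.comap (QuotientGroup.mk' N)) (hL.comap _) (lt_of_le_of_ne ?_ fun h => hL1 ?_)
    · exact QuotientGroup.le_comap_mk' N L
    · rw [← Subgroup.map_comap_eq_self_of_surjective (QuotientGroup.mk'_surjective N) L, ← h,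
        QuotientGroup.map_mk'_self]
  · rw [Subgroup.map_bot, Subgroup.mem_bot] at h
    exact Subgroup.normalClosure_le_normal
      (Set.singleton_subset_iff.2 ((QuotientGroup.eq_one_iff x).1 h)) hyx

end GroupClass

theorem proposition7p1 (C : GroupClass.{u}) (hroot : C.IsRootClass) (hper : C.IsPeriodic)
    (X : Type u) [Group X] (hX : C.IsBoundedNilpotent X) :
    C.IsResidually X ↔ HasNoTorsion (primeCompl C.primes) X :=
  ⟨fun h => h.hasNoTorsion hper, hX.isResidually hroot hper⟩
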